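/- Let $X$ be a complex Banach space with bidual $X^{**}$, regard $X$ as a subspace of $X^{**}$ through the canonical embedding, and for a complex Banach space $Y$ let $B_Y$ be its open unit ball and $H^\infty(B_Y)$ the algebra of bounded holomorphic functions $B_Y \to \mathbb{C}$ with pointwise operations and the supremum norm. Then there exists a unital algebra homomorphism $$E : H^\infty(B_X) \to H^\infty(B_{X^{**}})$$ of operator norm $\|E\| = 1$ such that $Ef|_{B_X} = f$ for all $f \in H^\infty(B_X)$. -/

import Mathlib

noncomputable section

/-- The open unit ball `B_X` of a normed space, as a subtype. -/
abbrev OpenUnitBall (X : Type*) [NormedAddCommGroup X] : Type _ :=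
  Metric.ball (0 : X) 1

/-- `H^∞(B_X)`: the algebra of bounded (Fréchet) holomorphic functions `B_X → ℂ`, with pointwise
operations and the supremum norm, both inherited from the bounded continuous functions on `B_X`
(a holomorphic function is continuous).  A function on the subtype `B_X` is holomorphic when it is
the restriction of some `F : X → ℂ` that is complex differentiable on `B_X`; as `B_X` is open, the
values of `F` off `B_X` play no role. -/
def HInfty (X : Type*) [NormedAddCommGroup X] [NormedSpace ℂ X] :
    Subalgebra ℂ (BoundedContinuousFunction (OpenUnitBall X) ℂ) where
  carrier := {f | ∃ F : X → ℂ, DifferentiableOn ℂ F (Metric.ball 0 1) ∧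
    ∀ x : OpenUnitBall X, F x = f x}
  mul_mem' := by
    rintro f g ⟨F, hF, hf⟩ ⟨G, hG, hg⟩
    exact ⟨F * G, hF.mul hG, fun x => by simp [hf, hg]⟩
  add_mem' := by
    rintro f g ⟨F, hF, hf⟩ ⟨G, hG, hg⟩
    exact ⟨F + G, hF.add hG, fun x => by simp [hf, hg]⟩
  algebraMap_mem' c := ⟨fun _ => c, differentiableOn_const c, fun x => by simp⟩

/-- The canonical embedding `X → X**` restricted to the open unit balls, `B_X → B_{X**}`. -/
def ballToBidual {X : Type*} [NormedAddCommGroup X] [NormedSpace ℂ X] (x : OpenUnitBall X) :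
    OpenUnitBall (StrongDual ℂ (StrongDual ℂ X)) :=
  ⟨NormedSpace.inclusionInDoubleDual ℂ X x, by
    have hx : ‖(x : X)‖ < 1 := mem_ball_zero_iff.mp x.2
    have h : ‖NormedSpace.inclusionInDoubleDual ℂ X x‖ < 1 :=
      (NormedSpace.double_dual_bound ℂ X x).trans_lt hx
    exact (mem_ball_zero_iff (E := StrongDual ℂ (StrongDual ℂ X))).mpr h⟩

end

/-! Let `J` embed `X` in its bidual. `E f z` is the limit of `f (g z)` along an ultrafilter of
linear maps `g` from the bidual to `X`. These need not be bounded, but `‖z - J y‖ < δ` forces `‖g z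
- y‖ < δ` eventually. For `y = 0` this puts `g z` in the unit ball, so limits respect the algebra
operations; for `z = J y` it gives `g z → y`, so `E f` extends `f`.

Such an ultrafilter exists by local reflexivity (`exists_linearMap_bidual_norm_sub_lt`), a
Hahn-Banach separation closed by Helly's theorem. Holomorphy survives the limit
(`differentiableOn_limUnder_comp_linearMap`) because the Schwarz lemma bounds the Taylor remainder
of `f` at `g z` uniformly in `g`. -/

open Filter Metric Topology

/-! ### Local reflexivity and the ultrafilter of linear maps -/

section Reflexivity

variable {X : Type*} [NormedAddCommGroup X] [NormedSpace ℂ X]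

/-- Helly's theorem for a single functional. -/
theorem exists_norm_lt_apply_eq_bidual (ζ : StrongDual ℂ (StrongDual ℂ X)) (ψ : StrongDual ℂ X)
    {δ : ℝ} (hδ : ‖ζ‖ < δ) : ∃ w : X, ‖w‖ < δ ∧ ψ w = ζ ψ := by
  have hδ0 : 0 < δ := (norm_nonneg ζ).trans_lt hδ
  by_cases h0 : ζ ψ = 0
  · exact ⟨0, by simpa using hδ0, by simp [h0]⟩
  by_contra! H
  have hψ : ψ ≠ 0 := by rintro rfl; simp at h0
  -- Any `x` with `ψ x ≠ 0` rescales to a solution of `ψ w = ζ ψ`, which by `H` has norm at least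
  -- `δ`.
  have hle : ‖ψ‖ ≤ ‖ζ ψ‖ / δ := by
    refine ψ.opNorm_le_bound (by positivity) fun x => ?_
    by_cases hx : ψ x = 0
    · rw [hx, norm_zero]; positivity
    have hw : δ ≤ ‖(ζ ψ / ψ x) • x‖ := by
      by_contra! hlt
      exact H _ hlt (by simp [hx])
    rw [norm_smul, norm_div, div_mul_eq_mul_div, le_div_iff₀ (norm_pos_iff.mpr hx)] at hw
    rw [div_mul_eq_mul_div, le_div_iff₀ hδ0]
    linarith
  rw [le_div_iff₀ hδ0] at hle
  have h1 := ζ.le_opNorm ψ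
  have h2 := mul_lt_mul_of_pos_right hδ (norm_pos_iff.mpr hψ)
  linarith

/-- A tensor in `V ⊗ X*` that annihilates all linear maps `V → X` is annihilated by every linear
map `V → X**`. -/
theorem sum_bidual_apply_eq_zero {V ι : Type*} [AddCommGroup V] [Module ℂ V] [Fintype ι]
    (z : ι → V) (φ : ι → StrongDual ℂ X) (h : ∀ g : V →ₗ[ℂ] X, ∑ i, φ i (g (z i)) = 0)
    (T : V →ₗ[ℂ] StrongDual ℂ (StrongDual ℂ X)) : ∑ i, T (z i) (φ i) = 0 := by
  classical
  let b := Module.Basis.ofVectorSpace ℂ V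
  -- Test the hypothesis on the rank-one maps `v ↦ b.coord j v • x`.
  have hb : ∀ j, ∑ i, b.repr (z i) j • φ i = 0 := by
    intro j
    ext x
    have := h ((b.coord j).smulRight x)
    simpa using this
  let s : Finset _ := Finset.univ.biUnion fun i => (b.repr (z i)).support
  have hz : ∀ i, z i = ∑ j ∈ s, b.repr (z i) j • b j := by
    intro i
    conv_lhs => rw [← b.linearCombination_repr (z i), Finsupp.linearCombination_apply]
    exact Finsupp.sum_of_support_subset _
      (Finset.subset_biUnion_of_mem (fun i => (b.repr (z i)).support) (Finset.mem_univ i)) _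
      (by simp)
  calc ∑ i, T (z i) (φ i) = ∑ i, ∑ j ∈ s, b.repr (z i) j * T (b j) (φ i) := by
        refine Finset.sum_congr rfl fun i _ => ?_
        conv_lhs => rw [hz i]
        simp [map_sum]
    _ = ∑ j ∈ s, T (b j) (∑ i, b.repr (z i) j • φ i) := by
        rw [Finset.sum_comm]
        simp [map_sum]
    _ = 0 := by simp [hb]

/-- A form of the principle of local reflexivity. -/
theorem exists_linearMap_bidual_norm_sub_lt {ι : Type*} [Fintype ι]
    (z : ι → StrongDual ℂ (StrongDual ℂ X)) (y : ι → X) (δ : ι → ℝ)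
    (h : ∀ i, ‖z i - NormedSpace.inclusionInDoubleDual ℂ X (y i)‖ < δ i) :
    ∃ g : StrongDual ℂ (StrongDual ℂ X) →ₗ[ℂ] X, ∀ i, ‖g (z i) - y i‖ < δ i := by
  classical
  by_contra! H
  let S : Set (ι → X) := Set.univ.pi fun i => ball 0 (δ i)
  let A : (StrongDual ℂ (StrongDual ℂ X) →ₗ[ℂ] X) →ₗ[ℝ] (ι → X) :=
    { toFun := fun g i => g (z i)
      map_add' := fun _ _ => rfl
      map_smul' := fun _ _ => rfl }
  let C : Set (ι → X) := (fun v => v - y) '' (LinearMap.range A : Set (ι → X))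
  have hS : Convex ℝ S := convex_pi fun i _ => convex_ball _ _
  have hSo : IsOpen S := isOpen_set_pi Set.finite_univ fun i _ => isOpen_ball
  have hC : Convex ℝ C := by
    have := (LinearMap.range A).convex.translate (-y)
    simpa [C, sub_eq_neg_add] using this
  have hd : Disjoint S C := by
    rw [Set.disjoint_left]
    rintro _ hv ⟨_, ⟨g, rfl⟩, rfl⟩
    obtain ⟨i, hi⟩ := H g
    have := hv i (Set.mem_univ i)
    rw [mem_ball_zero_iff] at this
    exact absurd this (not_lt.mpr hi)
  -- If no `g` works, the product of open balls misses the affine subspace of tuples `g (z i) - y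
  -- i`.
  obtain ⟨φ, u, hφS, hφC⟩ := RCLike.geometric_hahn_banach_open (𝕜 := ℂ) hS hSo hC hd
  let ψ : ι → StrongDual ℂ X := fun i => φ.comp (ContinuousLinearMap.single ℂ (fun _ => X) i)
  have hφ : ∀ v, φ v = ∑ i, ψ i (v i) := by
    intro v
    conv_lhs => rw [← Finset.univ_sum_single v]
    simp [ψ, map_sum]
  have hg : ∀ g : StrongDual ℂ (StrongDual ℂ X) →ₗ[ℂ] X, u ≤ (φ (A g - y)).re :=
    fun g => hφC _ ⟨_, ⟨g, rfl⟩, rfl⟩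
  have hzero : ∀ g : StrongDual ℂ (StrongDual ℂ X) →ₗ[ℂ] X, ∑ i, ψ i (g (z i)) = 0 := by
    intro g
    rw [← hφ fun i => g (z i)]
    by_contra hne
    -- This multiple of `g` makes `re φ (A g - y)` equal to `u - 1`, below the bound `u`.
    have key := hg (((u + (φ y).re - 1 : ℝ) / φ fun i => g (z i)) • g)
    have : A (((u + (φ y).re - 1 : ℝ) / φ fun i => g (z i)) • g) =
        ((u + (φ y).re - 1 : ℝ) / φ fun i => g (z i) : ℂ) • fun i => g (z i) := rfl
    rw [this, map_sub, map_smul, smul_eq_mul, div_mul_cancel₀ _ hne, Complex.sub_re,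
      Complex.ofReal_re] at key
    linarith
  have hsum := sum_bidual_apply_eq_zero z ψ hzero LinearMap.id
  -- Helly replaces `z i - J (y i)` by `w i` in the ball. As `∑ i, z i (ψ i) = 0`, `φ` takes the
  -- same value at `w` in `S` and at `-y` in `C`, contradicting the separation.
  choose w hw hwz using fun i => exists_norm_lt_apply_eq_bidual _ (ψ i) (h i)
  have hwS := hφS w fun i _ => by simpa using hw i
  have h0 := hg 0
  have : φ w = φ (A 0 - y) := by
    rw [hφ, hφ]
    simp only [hwz, LinearMap.id_apply] at hsum ⊢
    simp [Finset.sum_sub_distrib, hsum, A, NormedSpace.dual_def]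
  rw [← this] at h0
  exact absurd hwS (not_lt.mpr h0)

/-- Along `U`, linear maps `Y → X` asymptotically do not increase the distance to points of `X`,
embedded into `Y` by `J`. -/
def IsAsymptoticRetraction {X Y : Type*} [NormedAddCommGroup X] [NormedSpace ℂ X]
    [NormedAddCommGroup Y] [NormedSpace ℂ Y] (J : X →L[ℂ] Y) (U : Ultrafilter (Y →ₗ[ℂ] X)) :
    Prop :=
  ∀ (z : Y) (y : X) (δ : ℝ), ‖z - J y‖ < δ → ∀ᶠ g : Y →ₗ[ℂ] X in U, ‖g z - y‖ < δ

/-- Local reflexivity for finite families is the finite intersection property of the required sets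
of maps. -/
theorem exists_isAsymptoticRetraction_bidual (X : Type*) [NormedAddCommGroup X]
    [NormedSpace ℂ X] :
    ∃ U, IsAsymptoticRetraction (X := X) (Y := StrongDual ℂ (StrongDual ℂ X))
      (NormedSpace.inclusionInDoubleDual ℂ X) U := by
  let I := {p : StrongDual ℂ (StrongDual ℂ X) × X × ℝ //
    ‖p.1 - NormedSpace.inclusionInDoubleDual ℂ X p.2.1‖ < p.2.2}
  let S : I → Set (StrongDual ℂ (StrongDual ℂ X) →ₗ[ℂ] X) :=
    fun p => {g | ‖g p.1.1 - p.1.2.1‖ < p.1.2.2}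
  have hne : (generate (Set.range S)).NeBot := by
    rw [generate_neBot_iff]
    intro t ht hfin
    have := hfin.fintype
    choose p hp using fun V : t => ht V.2
    obtain ⟨g, hg⟩ := exists_linearMap_bidual_norm_sub_lt (fun V : t => (p V).1.1)
      (fun V => (p V).1.2.1) (fun V => (p V).1.2.2) fun V => (p V).2
    refine ⟨g, fun V hV => ?_⟩
    have hS : g ∈ S (p ⟨V, hV⟩) := hg ⟨V, hV⟩
    rwa [hp] at hS
  refine ⟨Ultrafilter.of (generate (Set.range S)), fun z y δ h => ?_⟩
  exact Ultrafilter.of_le _ (mem_generate_of_mem ⟨⟨(z, y, δ), h⟩, rfl⟩)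

end Reflexivity

/-! ### Cauchy and Schwarz estimates -/

section Taylor

variable {X : Type*} [NormedAddCommGroup X] [NormedSpace ℂ X]

theorem norm_fderiv_le_of_norm_le_ball {F : X → ℂ} {c : X} {R M : ℝ} (hR : 0 < R)
    (hF : DifferentiableOn ℂ F (ball c R)) (hM : ∀ x, ‖F x‖ ≤ M) :
    ‖fderiv ℂ F c‖ ≤ 2 * M / R := by
  refine Complex.norm_fderiv_le_div_of_mapsTo_ball hF (fun x _ => ?_) hR
  rw [mem_closedBall_iff_norm]
  linarith [norm_sub_le (F x) (F c), hM x, hM c]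

/-- A uniform second order remainder estimate for bounded holomorphic functions. -/
theorem norm_sub_sub_fderiv_le_of_norm_le_ball {F : X → ℂ} {c v : X} {R M : ℝ}
    (hF : DifferentiableOn ℂ F (ball c R)) (hM : ∀ x, ‖F x‖ ≤ M) (hv : ‖v‖ < R) :
    ‖F (c + v) - F c - fderiv ℂ F c v‖ ≤ 4 * M * (‖v‖ / R) ^ 2 := by
  have hR : 0 < R := (norm_nonneg v).trans_lt hv
  have hd := (hF.differentiableAt (ball_mem_nhds c hR)).hasFDerivAt
  -- Schwarz lemma for the remainder, which is `o(‖x - c‖)`; the bound `4 * M` is `M + M` from the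
  -- values of `F` and `2 * M` from the derivative term.
  have key := Complex.dist_le_mul_div_pow_of_mapsTo_ball_of_isLittleO (n := 1) (c := c)
    (z := c + v) (R₁ := R) (R₂ := 4 * M) (f := fun x => F x - F c - fderiv ℂ F c (x - c))
    ((hF.sub_const _).sub (by fun_prop)) ?_ ?_ (by simpa using hv)
  · simpa [dist_eq_norm] using key
  · intro x hx
    rw [mem_ball_iff_norm] at hx
    simp only [sub_self, map_zero, mem_closedBall_zero_iff]
    have h1 := (fderiv ℂ F c).le_opNorm (x - c)
    have h2 := norm_fderiv_le_of_norm_le_ball hR hF hM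
    have h3 : ‖fderiv ℂ F c‖ * ‖x - c‖ ≤ 2 * M / R * R :=
      mul_le_mul h2 hx.le (norm_nonneg _) ((norm_nonneg _).trans h2)
    rw [div_mul_cancel₀ _ hR.ne'] at h3
    linarith [norm_sub_le (F x - F c) (fderiv ℂ F c (x - c)), norm_sub_le (F x) (F c), hM x, hM c]
  · simpa using hd.isLittleO.norm_right

end Taylor

/-! ### Holomorphy of ultrafilter limits -/

section UltrafilterLimit

theorem Ultrafilter.tendsto_limUnder_of_norm_le {α : Type*} (U : Ultrafilter α) {φ : α → ℂ}
    {M : ℝ} (h : ∀ᶠ a in U, ‖φ a‖ ≤ M) : Tendsto φ U (𝓝 (limUnder (U : Filter α) φ)) := by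
  obtain ⟨c, -, hc⟩ := (isCompact_closedBall (0 : ℂ) M).ultrafilter_le_nhds (U.map φ) (by
    rw [Ultrafilter.coe_map, le_principal_iff, Filter.mem_map]
    filter_upwards [h] with a ha
    simpa using ha)
  exact tendsto_nhds_limUnder ⟨c, hc⟩

variable {X Y : Type*} [NormedAddCommGroup X] [NormedSpace ℂ X] [NormedAddCommGroup Y]
  [NormedSpace ℂ Y]

/-- The limit of a bounded holomorphic function along asymptotically contractive linear maps is
holomorphic. -/
theorem differentiableOn_limUnder_comp_linearMap (U : Ultrafilter (Y →ₗ[ℂ] X))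
    (hU : ∀ (z : Y) (δ : ℝ), ‖z‖ < δ → ∀ᶠ g : Y →ₗ[ℂ] X in U, ‖g z‖ < δ) {F : X → ℂ} {M : ℝ}
    (hF : DifferentiableOn ℂ F (ball 0 1)) (hM : ∀ x, ‖F x‖ ≤ M) :
    DifferentiableOn ℂ (fun z : Y => limUnder (U : Filter (Y →ₗ[ℂ] X)) fun g => F (g z))
      (ball 0 1) := by
  intro a ha
  rw [mem_ball_zero_iff] at ha
  have hM0 : 0 ≤ M := (norm_nonneg _).trans (hM 0)
  obtain ⟨r, har, hr⟩ := exists_between ha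
  set R := 1 - r
  have hR : 0 < R := by linarith
  -- One radius `R` serves eventually all `g`, which makes the estimates below uniform.
  have hball : ∀ᶠ g : Y →ₗ[ℂ] X in U, DifferentiableOn ℂ F (ball (g a) R) := by
    filter_upwards [hU a r har] with g hg
    refine hF.mono fun x hx => ?_
    rw [mem_ball_iff_norm] at hx
    rw [mem_ball_zero_iff]
    linarith [norm_sub_norm_le x (g a)]
  have hlim := fun z : Y => U.tendsto_limUnder_of_norm_le (φ := fun g => F (g z))
    (Eventually.of_forall fun g => hM (g z))
  have hbd : ∀ (h : Y) (s : ℝ), ‖h‖ < s →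
      ∀ᶠ g : Y →ₗ[ℂ] X in U, ‖fderiv ℂ F (g a) (g h)‖ ≤ 2 * M / R * s := by
    intro h s hs
    filter_upwards [hball, hU h s hs] with g hg hgh
    exact (ContinuousLinearMap.le_opNorm _ _).trans <| mul_le_mul
      (norm_fderiv_le_of_norm_le_ball hR hg hM) hgh.le (norm_nonneg _) (by positivity)
  have hDlim := fun h : Y => U.tendsto_limUnder_of_norm_le (hbd h (‖h‖ + 1) (by linarith))
  -- The candidate derivative is the limit of the derivatives of `F ∘ g` at `a`.
  let L₀ : Y →ₗ[ℂ] ℂ :=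
    { toFun := fun h => limUnder (U : Filter (Y →ₗ[ℂ] X)) fun g => fderiv ℂ F (g a) (g h)
      map_add' := fun h k => tendsto_nhds_unique (hDlim (h + k)) <| by
        simpa using (hDlim h).add (hDlim k)
      map_smul' := fun c h => tendsto_nhds_unique (hDlim (c • h)) <| by
        simpa using (hDlim h).const_mul c }
  have hL₀ : ∀ h, ‖L₀ h‖ ≤ 2 * M / R * ‖h‖ := by
    intro h
    -- `‖g h‖ < s` holds eventually only for `s > ‖h‖`, so the bound is obtained by letting `s`
    -- decrease to `‖h‖`.
    have hcont : Tendsto (fun s : ℝ => 2 * M / R * s) (𝓝[>] ‖h‖) (𝓝 (2 * M / R * ‖h‖)) :=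
      ((continuous_const_mul _).tendsto _).mono_left nhdsWithin_le_nhds
    refine ge_of_tendsto hcont ?_
    filter_upwards [self_mem_nhdsWithin] with s hs
    exact le_of_tendsto (hDlim h).norm (hbd h s hs)
  let L : Y →L[ℂ] ℂ := L₀.mkContinuous (2 * M / R) hL₀
  refine HasFDerivAt.differentiableAt (f' := L) ?_ |>.differentiableWithinAt
  rw [hasFDerivAt_iff_isLittleO_nhds_zero]
  have hO : (fun h : Y => (limUnder (U : Filter (Y →ₗ[ℂ] X)) fun g => F (g (a + h))) -
      (limUnder (U : Filter (Y →ₗ[ℂ] X)) fun g => F (g a)) - L h) =O[𝓝 0] fun h => ‖h‖ ^ 2 := by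
    refine Asymptotics.IsBigO.of_bound (4 * M * (1 / R) ^ 2) ?_
    filter_upwards [ball_mem_nhds (0 : Y) hR] with h hh
    rw [mem_ball_zero_iff] at hh
    have hT := ((hlim (a + h)).sub (hlim a)).sub (hDlim h)
    have hcont : Tendsto (fun s : ℝ => 4 * M * (s / R) ^ 2) (𝓝[>] ‖h‖)
        (𝓝 (4 * M * (‖h‖ / R) ^ 2)) := by
      have : Continuous fun s : ℝ => 4 * M * (s / R) ^ 2 := by fun_prop
      exact (this.tendsto _).mono_left nhdsWithin_le_nhds
    have hle : ‖(limUnder (U : Filter (Y →ₗ[ℂ] X)) fun g => F (g (a + h))) -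
        (limUnder (U : Filter (Y →ₗ[ℂ] X)) fun g => F (g a)) - L h‖ ≤
          4 * M * (‖h‖ / R) ^ 2 := by
      refine ge_of_tendsto hcont ?_
      filter_upwards [self_mem_nhdsWithin, nhdsWithin_le_nhds (Iio_mem_nhds hh)] with s hs hsR
      refine le_of_tendsto hT.norm ?_
      filter_upwards [hball, hU h s hs] with g hg hgh
      rw [map_add]
      refine (norm_sub_sub_fderiv_le_of_norm_le_ball hg hM (hgh.trans hsR)).trans ?_
      gcongr
    refine hle.trans_eq ?_
    rw [Real.norm_of_nonneg (by positivity)]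
    ring
  exact hO.trans_isLittleO (by
    simpa using (Asymptotics.isLittleO_norm_pow_id (E' := Y) one_lt_two))

end UltrafilterLimit

/-! ### The extension homomorphism -/

noncomputable section Extension

open Classical in
/-- The extension by zero of a function on the open unit ball. -/
def OpenUnitBall.extendZero {X : Type*} [NormedAddCommGroup X] (f : OpenUnitBall X → ℂ) (x : X) :
    ℂ :=
  if h : x ∈ ball (0 : X) 1 then f ⟨x, h⟩ else 0

theorem OpenUnitBall.extendZero_of_mem {X : Type*} [NormedAddCommGroup X] (f : OpenUnitBall X → ℂ) {x : X}
    (h : x ∈ ball (0 : X) 1) : OpenUnitBall.extendZero f x = f ⟨x, h⟩ := dif_pos h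

variable {X : Type*} [NormedAddCommGroup X] [NormedSpace ℂ X]

theorem HInfty.norm_extendZero_le (f : HInfty X) (x : X) :
    ‖OpenUnitBall.extendZero f.1 x‖ ≤ ‖f‖ := by
  unfold OpenUnitBall.extendZero
  split_ifs with h
  · exact f.1.norm_coe_le_norm _
  · rw [norm_zero]
    exact norm_nonneg f

theorem HInfty.differentiableOn_extendZero (f : HInfty X) :
    DifferentiableOn ℂ (OpenUnitBall.extendZero f.1) (ball 0 1) := by
  obtain ⟨F, hF, h⟩ := f.2
  exact hF.congr fun x hx => (OpenUnitBall.extendZero_of_mem _ hx).trans (h ⟨x, hx⟩).symm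

variable {Y : Type*} [NormedAddCommGroup Y] [NormedSpace ℂ Y] (U : Ultrafilter (Y →ₗ[ℂ] X))

/-- The limit of `f (g z)` along an ultrafilter of linear maps `g`. -/
def HInfty.ultraExtend (f : HInfty X) (z : Y) : ℂ :=
  limUnder (U : Filter (Y →ₗ[ℂ] X)) fun g => OpenUnitBall.extendZero f.1 (g z)

theorem HInfty.tendsto_ultraExtend (f : HInfty X) (z : Y) :
    Tendsto (fun g : Y →ₗ[ℂ] X => OpenUnitBall.extendZero f.1 (g z)) U (𝓝 (HInfty.ultraExtend U f z)) :=
  U.tendsto_limUnder_of_norm_le (Eventually.of_forall fun g => HInfty.norm_extendZero_le f (g z))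

theorem HInfty.norm_ultraExtend_le (f : HInfty X) (z : Y) : ‖HInfty.ultraExtend U f z‖ ≤ ‖f‖ :=
  le_of_tendsto (HInfty.tendsto_ultraExtend U f z).norm
    (Eventually.of_forall fun g => HInfty.norm_extendZero_le f (g z))

theorem HInfty.ultraExtend_add (f g : HInfty X) {z : Y}
    (hz : ∀ᶠ T : Y →ₗ[ℂ] X in U, T z ∈ ball (0 : X) 1) :
    HInfty.ultraExtend U (f + g) z = HInfty.ultraExtend U f z + HInfty.ultraExtend U g z := by
  refine tendsto_nhds_unique (HInfty.tendsto_ultraExtend U (f + g) z) <|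
    ((HInfty.tendsto_ultraExtend U f z).add (HInfty.tendsto_ultraExtend U g z)).congr' ?_
  filter_upwards [hz] with T hT
  simp only [OpenUnitBall.extendZero_of_mem _ hT]
  rfl

theorem HInfty.ultraExtend_mul (f g : HInfty X) {z : Y}
    (hz : ∀ᶠ T : Y →ₗ[ℂ] X in U, T z ∈ ball (0 : X) 1) :
    HInfty.ultraExtend U (f * g) z = HInfty.ultraExtend U f z * HInfty.ultraExtend U g z := by
  refine tendsto_nhds_unique (HInfty.tendsto_ultraExtend U (f * g) z) <|
    ((HInfty.tendsto_ultraExtend U f z).mul (HInfty.tendsto_ultraExtend U g z)).congr' ?_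
  filter_upwards [hz] with T hT
  simp only [OpenUnitBall.extendZero_of_mem _ hT]
  rfl

theorem HInfty.ultraExtend_algebraMap (c : ℂ) {z : Y}
    (hz : ∀ᶠ T : Y →ₗ[ℂ] X in U, T z ∈ ball (0 : X) 1) :
    HInfty.ultraExtend U (algebraMap ℂ (HInfty X) c) z = c := by
  refine tendsto_nhds_unique (HInfty.tendsto_ultraExtend U _ _) <| tendsto_const_nhds.congr' ?_
  filter_upwards [hz] with T hT
  rw [OpenUnitBall.extendZero_of_mem _ hT]
  rfl

theorem HInfty.differentiableOn_ultraExtend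
    (hU : ∀ (z : Y) (δ : ℝ), ‖z‖ < δ → ∀ᶠ g : Y →ₗ[ℂ] X in U, ‖g z‖ < δ) (f : HInfty X) :
    DifferentiableOn ℂ (HInfty.ultraExtend U f) (ball 0 1) :=
  differentiableOn_limUnder_comp_linearMap U hU (HInfty.differentiableOn_extendZero f)
    (HInfty.norm_extendZero_le f)

/-- The extension of bounded holomorphic functions along an ultrafilter of asymptotically
contractive linear maps, as a bounded holomorphic function. -/
def HInfty.ultraExtension
    (hU : ∀ (z : Y) (δ : ℝ), ‖z‖ < δ → ∀ᶠ g : Y →ₗ[ℂ] X in U, ‖g z‖ < δ) (f : HInfty X) :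
    HInfty Y :=
  ⟨BoundedContinuousFunction.ofNormedAddCommGroup (fun z => HInfty.ultraExtend U f z)
    (HInfty.differentiableOn_ultraExtend U hU f).continuousOn.domRestrict ‖f‖
    fun z => HInfty.norm_ultraExtend_le U f z,
    HInfty.ultraExtend U f, HInfty.differentiableOn_ultraExtend U hU f, fun _ => rfl⟩

theorem HInfty.norm_ultraExtension_le
    (hU : ∀ (z : Y) (δ : ℝ), ‖z‖ < δ → ∀ᶠ g : Y →ₗ[ℂ] X in U, ‖g z‖ < δ) (f : HInfty X) :
    ‖HInfty.ultraExtension U hU f‖ ≤ ‖f‖ :=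
  (BoundedContinuousFunction.norm_le (norm_nonneg f)).mpr fun z => HInfty.norm_ultraExtend_le U f z

/-- The extension of bounded holomorphic functions along an ultrafilter of asymptotically
contractive linear maps, as an algebra homomorphism. -/
def HInfty.ultraExtendAlgHom
    (hU : ∀ (z : Y) (δ : ℝ), ‖z‖ < δ → ∀ᶠ g : Y →ₗ[ℂ] X in U, ‖g z‖ < δ) :
    HInfty X →ₐ[ℂ] HInfty Y :=
  -- Eventually `g z` lies in the unit ball, so the default value zero does not affect the limit.
  have hmem (z : OpenUnitBall Y) : ∀ᶠ g : Y →ₗ[ℂ] X in U, g (z : Y) ∈ ball (0 : X) 1 := by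
    simpa using hU z 1 (mem_ball_zero_iff.mp z.2)
  have hconst (c : ℂ) : HInfty.ultraExtension U hU (algebraMap ℂ (HInfty X) c) =
      algebraMap ℂ (HInfty Y) c :=
    Subtype.ext <| BoundedContinuousFunction.ext fun z => HInfty.ultraExtend_algebraMap U c (hmem z)
  { toFun := HInfty.ultraExtension U hU
    map_one' := by simpa only [map_one] using hconst 1
    map_zero' := by simpa only [map_zero] using hconst 0
    commutes' := hconst
    map_add' := fun f g => Subtype.ext <| BoundedContinuousFunction.ext fun z =>
      HInfty.ultraExtend_add U f g (hmem z)
    map_mul' := fun f g => Subtype.ext <| BoundedContinuousFunction.ext fun z =>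
      HInfty.ultraExtend_mul U f g (hmem z) }

/-- The extension of bounded holomorphic functions along an ultrafilter of asymptotically
contractive linear maps, as a continuous algebra homomorphism. -/
def HInfty.ultraExtendContinuousAlgHom
    (hU : ∀ (z : Y) (δ : ℝ), ‖z‖ < δ → ∀ᶠ g : Y →ₗ[ℂ] X in U, ‖g z‖ < δ) :
    HInfty X →A[ℂ] HInfty Y :=
  { HInfty.ultraExtendAlgHom U hU with
    cont := AddMonoidHomClass.continuous_of_bound (HInfty.ultraExtendAlgHom U hU) 1 fun f =>
      (HInfty.norm_ultraExtension_le U hU f).trans_eq (one_mul _).symm }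

theorem HInfty.norm_one (X : Type*) [NormedAddCommGroup X] [NormedSpace ℂ X] :
    ‖(1 : HInfty X)‖ = 1 :=
  have : Nonempty (OpenUnitBall X) := ⟨⟨0, mem_ball_self one_pos⟩⟩
  NormOneClass.norm_one (α := BoundedContinuousFunction (OpenUnitBall X) ℂ)

theorem HInfty.norm_ultraExtendContinuousAlgHom
    (hU : ∀ (z : Y) (δ : ℝ), ‖z‖ < δ → ∀ᶠ g : Y →ₗ[ℂ] X in U, ‖g z‖ < δ) :
    ‖(HInfty.ultraExtendContinuousAlgHom U hU).toContinuousLinearMap‖ = 1 := by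
  refine le_antisymm (ContinuousLinearMap.opNorm_le_bound _ zero_le_one fun f =>
    (HInfty.norm_ultraExtension_le U hU f).trans_eq (one_mul _).symm) ?_
  -- The lower bound on the norm comes from `E 1 = 1`.
  have h := (HInfty.ultraExtendContinuousAlgHom U hU).toContinuousLinearMap.le_opNorm 1
  have h1 : (HInfty.ultraExtendContinuousAlgHom U hU).toContinuousLinearMap 1 = 1 :=
    map_one (HInfty.ultraExtendAlgHom U hU)
  rwa [h1, HInfty.norm_one, HInfty.norm_one, mul_one] at h

/-- The extension agrees with `f` at the limit of `g z`. -/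
theorem HInfty.ultraExtend_eq_of_tendsto (f : HInfty X) {z : Y} {x : OpenUnitBall X}
    (h : Tendsto (fun g : Y →ₗ[ℂ] X => g z) U (𝓝 (x : X))) : HInfty.ultraExtend U f z = f.1 x := by
  have hc : ContinuousAt (OpenUnitBall.extendZero f.1) (x : X) :=
    (HInfty.differentiableOn_extendZero f).continuousOn.continuousAt (isOpen_ball.mem_nhds x.2)
  rw [tendsto_nhds_unique (HInfty.tendsto_ultraExtend U f z) (hc.tendsto.comp h),
    OpenUnitBall.extendZero_of_mem _ x.2]

theorem IsAsymptoticRetraction.exists_extension {J : X →L[ℂ] Y} {U : Ultrafilter (Y →ₗ[ℂ] X)}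
    (hU : IsAsymptoticRetraction J U) :
    ∃ E : HInfty X →A[ℂ] HInfty Y, ‖E.toContinuousLinearMap‖ = 1 ∧
      ∀ (f : HInfty X) (x : OpenUnitBall X) (w : OpenUnitBall Y), (w : Y) = J x →
        (E f).1 w = f.1 x := by
  have hU0 : ∀ (z : Y) (δ : ℝ), ‖z‖ < δ → ∀ᶠ g : Y →ₗ[ℂ] X in U, ‖g z‖ < δ :=
    fun z δ h => by simpa using hU z 0 δ (by simpa using h)
  refine ⟨HInfty.ultraExtendContinuousAlgHom U hU0,
    HInfty.norm_ultraExtendContinuousAlgHom U hU0, fun f x w hw => ?_⟩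
  refine HInfty.ultraExtend_eq_of_tendsto U f ?_
  rw [Metric.tendsto_nhds]
  intro ε hε
  -- As `w = J x`, the distance `‖w - J x‖ = 0` is below every `ε`, so `g w → x`.
  simpa [dist_eq_norm] using hU w x ε (by simpa [hw] using hε)

end Extension

theorem theorem2p3 {X : Type*} [NormedAddCommGroup X] [NormedSpace ℂ X] [CompleteSpace X] :
    ∃ E : HInfty X →A[ℂ] HInfty (StrongDual ℂ (StrongDual ℂ X)),
      ‖E.toContinuousLinearMap‖ = 1 ∧
      ∀ (f : HInfty X) (x : OpenUnitBall X),
        (E f).1 (ballToBidual x) = f.1 x := by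
  obtain ⟨U, hU⟩ := exists_isAsymptoticRetraction_bidual X
  obtain ⟨E, hE, hEx⟩ := hU.exists_extension
  exact ⟨E, hE, fun f x => hEx f x (ballToBidual x) rfl⟩
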